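/- Let $\mathcal H$ be a complex Hilbert space and let $S,T\in\mathcal B(\mathcal H)$ be bounded linear operators. Let $f,g$ be non-negative continuous functions on $[0,\infty)$ satisfying $f(t)g(t)=t$ for all $t\ge 0$. Then \[ \pm\,\mathcal R(ST)\ \le\ \frac12\Big(\big(S\,g^{2}(|T^{*}|)\,S^{*}\big)\,\sharp\,|S^{*}|^{2}\;+\;f(|T|)\,|T|\Big) \] in the Löwner order, where $\mathcal R X=\frac12(X+X^{*})$, $|X|=(X^{*}X)^{1/2}$, the operators $f(|T|)$ and $g^{2}(|T^{*}|)=\big(g(|T^{*}|)\big)^{2}$ are given by the continuous functional calculus, and $\sharp$ is the operator geometric mean: for positive semi-definite $A,B\in\mathcal B(\mathcal H)$ with $A$ invertible, $A\,\sharp\,B=A^{1/2}\big(A^{-1/2}BA^{-1/2}\big)^{1/2}A^{1/2}$, and for arbitrary positive semi-definite $A,B$, $A\,\sharp\,B$ is the limit of $(A+\varepsilon I)\,\sharp\,(B+\varepsilon I)$ in the strong operator topology as $\varepsilon\downarrow 0$. -/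

import Mathlib

open Filter Topology
open scoped ComplexStarModule

namespace OpMean

variable {H : Type*} [NormedAddCommGroup H] [InnerProductSpace ℂ H] [CompleteSpace H]

/-- The expression `A^{1/2} (A^{-1/2} B A^{-1/2})^{1/2} A^{1/2}`, which is the geometric mean of
`A` and `B` when `A` is positive and invertible and `B` is positive. -/
noncomputable def geoFormula (A B : H →L[ℂ] H) : H →L[ℂ] H :=
  A ^ (1 / 2 : ℝ) * (A ^ (-(1 / 2) : ℝ) * B * A ^ (-(1 / 2) : ℝ)) ^ (1 / 2 : ℝ) * A ^ (1 / 2 : ℝ)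

/-- `G` is the limit, in the strong operator topology, of the geometric means of the positive
invertible operators `A + ε` and `B + ε` as `ε` decreases to `0`. -/
def IsGeoMean (A B G : H →L[ℂ] H) : Prop :=
  ∀ x : H, Tendsto
    (fun ε : ℝ => geoFormula (A + ε • (1 : H →L[ℂ] H)) (B + ε • (1 : H →L[ℂ] H)) x)
    (𝓝[>] 0) (𝓝 (G x))

open Classical in
/-- The geometric mean `A ♯ B` of two positive semi-definite operators, not necessarily
invertible: the strong limit of the geometric means of `A + ε` and `B + ε` as `ε ↓ 0`.  For
positive semi-definite `A` and `B` the limit exists (`geoMean_spec`), and for invertible `A` it is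
`A^{1/2} (A^{-1/2} B A^{-1/2})^{1/2} A^{1/2}` (`geoMean_of_isUnit`). -/
noncomputable def geoMean (A B : H →L[ℂ] H) : H →L[ℂ] H :=
  if h : ∃ G : H →L[ℂ] H, IsGeoMean A B G then h.choose else 0

lemma IsGeoMean.unique {A B G G' : H →L[ℂ] H} (h : IsGeoMean A B G) (h' : IsGeoMean A B G') :
    G = G' := by
  ext x
  exact tendsto_nhds_unique (h x) (h' x)

lemma geoMean_eq {A B G : H →L[ℂ] H} (h : IsGeoMean A B G) : geoMean A B = G := by
  have hex : ∃ G : H →L[ℂ] H, IsGeoMean A B G := ⟨G, h⟩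
  rw [geoMean, dif_pos hex]
  exact hex.choose_spec.unique h

lemma isStrictlyPositive_add_smul {A : H →L[ℂ] H} (hA : 0 ≤ A) {ε : ℝ} (hε : 0 < ε) :
    IsStrictlyPositive (A + ε • (1 : H →L[ℂ] H)) := by
  have h1 : IsStrictlyPositive (ε • (1 : H →L[ℂ] H)) :=
    IsStrictlyPositive.smul hε isStrictlyPositive_one
  exact h1.of_le (le_add_of_nonneg_left hA)

lemma geoFormula_nonneg (A B : H →L[ℂ] H) : 0 ≤ geoFormula A B := by
  have h : IsSelfAdjoint (A ^ (1 / 2 : ℝ)) := IsSelfAdjoint.of_nonneg CFC.rpow_nonneg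
  exact h.conjugate_nonneg CFC.rpow_nonneg

lemma half_mul_half {A : H →L[ℂ] H} (hA : IsStrictlyPositive A) :
    A ^ (1 / 2 : ℝ) * A ^ (1 / 2 : ℝ) = A := by
  rw [← CFC.rpow_add hA.isUnit]
  norm_num
  exact CFC.rpow_one A hA.nonneg

lemma neg_half_mul_neg_half {A : H →L[ℂ] H} (hA : IsStrictlyPositive A) :
    A ^ (-(1 / 2) : ℝ) * A ^ (-(1 / 2) : ℝ) = A ^ (-1 : ℝ) := by
  rw [← CFC.rpow_add hA.isUnit]
  norm_num

lemma geoFormula_riccati {A B : H →L[ℂ] H} (hA : IsStrictlyPositive A) (hB : 0 ≤ B) :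
    geoFormula A B * A ^ (-1 : ℝ) * geoFormula A B = B := by
  have h1 := CFC.rpow_mul_rpow_neg (1 / 2) hA
  have h2 := CFC.rpow_neg_mul_rpow (1 / 2) hA
  have hs : IsSelfAdjoint (A ^ (-(1 / 2) : ℝ)) := IsSelfAdjoint.of_nonneg CFC.rpow_nonneg
  have hC : 0 ≤ A ^ (-(1 / 2) : ℝ) * B * A ^ (-(1 / 2) : ℝ) := hs.conjugate_nonneg hB
  have h3 : (A ^ (-(1 / 2) : ℝ) * B * A ^ (-(1 / 2) : ℝ)) ^ (1 / 2 : ℝ) *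
      (A ^ (-(1 / 2) : ℝ) * B * A ^ (-(1 / 2) : ℝ)) ^ (1 / 2 : ℝ) =
      A ^ (-(1 / 2) : ℝ) * B * A ^ (-(1 / 2) : ℝ) := by
    rw [← CFC.sqrt_eq_rpow]
    exact CFC.sqrt_mul_sqrt_self _ hC
  rw [← neg_half_mul_neg_half hA, geoFormula]
  set P := A ^ (1 / 2 : ℝ)
  set Q := A ^ (-(1 / 2) : ℝ)
  set R := (Q * B * Q) ^ (1 / 2 : ℝ)
  calc P * R * P * (Q * Q) * (P * R * P)
      = P * R * (P * Q) * (Q * P) * R * P := by noncomm_ring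
    _ = P * (R * R) * P := by rw [h1, h2]; noncomm_ring
    _ = (P * Q) * B * (Q * P) := by rw [h3]; noncomm_ring
    _ = B := by rw [h1, h2]; simp

lemma geoFormula_mono {A A' B B' : H →L[ℂ] H} (hA : IsStrictlyPositive A) (hB : 0 ≤ B)
    (hAA : A ≤ A') (hBB : B ≤ B') : geoFormula A B ≤ geoFormula A' B' := by
  have hA' : IsStrictlyPositive A' := hA.of_le hAA
  set G := geoFormula A B with hG
  have hG0 : 0 ≤ G := geoFormula_nonneg A B
  have hGs : IsSelfAdjoint G := IsSelfAdjoint.of_nonneg hG0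
  have h1 : G * A' ^ (-1 : ℝ) * G ≤ B' := by
    refine le_trans (hGs.conjugate_le_conjugate
      (CStarAlgebra.rpow_neg_one_le_rpow_neg_one hAA hA)) ?_
    rw [hG, geoFormula_riccati hA hB]
    exact hBB
  have e1 := CFC.rpow_mul_rpow_neg (1 / 2) hA'
  have e2 := CFC.rpow_neg_mul_rpow (1 / 2) hA'
  have hP : IsSelfAdjoint (A' ^ (1 / 2 : ℝ)) := IsSelfAdjoint.of_nonneg CFC.rpow_nonneg
  have hQ : IsSelfAdjoint (A' ^ (-(1 / 2) : ℝ)) := IsSelfAdjoint.of_nonneg CFC.rpow_nonneg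
  rw [← neg_half_mul_neg_half hA'] at h1
  have h2 := hQ.conjugate_le_conjugate h1
  rw [geoFormula]
  set P := A' ^ (1 / 2 : ℝ)
  set Q := A' ^ (-(1 / 2) : ℝ)
  have h3 : Q * (G * (Q * Q) * G) * Q = (Q * G * Q) * (Q * G * Q) := by noncomm_ring
  rw [h3] at h2
  have h4 := CFC.sqrt_le_sqrt _ _ h2
  rw [CFC.sqrt_mul_self _ (hQ.conjugate_nonneg hG0), CFC.sqrt_eq_rpow] at h4
  have h5 := hP.conjugate_le_conjugate h4
  have h6 : P * (Q * G * Q) * P = (P * Q) * G * (Q * P) := by noncomm_ring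
  rwa [h6, e1, e2, one_mul, mul_one] at h5

lemma norm_apply_sq_le {D : H →L[ℂ] H} (hD : 0 ≤ D) (x : H) :
    ‖D x‖ ^ 2 ≤ ‖D‖ * (inner ℂ (D x) x).re := by
  have hs : IsSelfAdjoint (CFC.sqrt D) := IsSelfAdjoint.of_nonneg (CFC.sqrt_nonneg D)
  have hss : CFC.sqrt D * CFC.sqrt D = D := CFC.sqrt_mul_sqrt_self D hD
  have h1 : (inner ℂ (D x) x).re = ‖CFC.sqrt D x‖ ^ 2 := by
    have h2 : (inner ℂ (D x) x : ℂ) = inner ℂ (CFC.sqrt D x) (CFC.sqrt D x) := by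
      conv_lhs => rw [← hss]
      exact hs.isSymmetric _ _
    rw [h2]
    exact inner_self_eq_norm_sq (𝕜 := ℂ) _
  have h3 : ‖CFC.sqrt D‖ ^ 2 = ‖D‖ := by
    have h4 := CStarRing.norm_star_mul_self (x := CFC.sqrt D)
    rw [hs.star_eq, hss] at h4
    rw [h4, sq]
  have h5 : ‖D x‖ ≤ ‖CFC.sqrt D‖ * ‖CFC.sqrt D x‖ := by
    conv_lhs => rw [← hss]
    exact (CFC.sqrt D).le_opNorm _
  rw [h1, ← h3, ← mul_pow]
  exact pow_le_pow_left₀ (norm_nonneg _) h5 2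

/-- A family of positive operators that decreases as the parameter decreases to `0` converges
strongly. -/
lemma exists_strong_limit (M : ℝ → H →L[ℂ] H) (h0 : ∀ ε, 0 ≤ M ε)
    (hM : ∀ ε δ, 0 < ε → ε ≤ δ → M ε ≤ M δ) :
    ∃ G : H →L[ℂ] H, ∀ x, Tendsto (fun ε => M ε x) (𝓝[>] 0) (𝓝 (G x)) := by
  have hre : ∀ (D : H →L[ℂ] H) (x : H), 0 ≤ D → 0 ≤ (inner ℂ (D x) x).re := fun D x hD =>
    ((ContinuousLinearMap.nonneg_iff_isPositive D).1 hD).re_inner_nonneg_left x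
  have key : ∀ x, ∃ y, Tendsto (fun ε => M ε x) (𝓝[>] 0) (𝓝 y) := by
    intro x
    set φ : ℝ → ℝ := fun ε => (inner ℂ (M ε x) x).re with hφ
    have hdiff : ∀ ε δ, (inner ℂ ((M δ - M ε) x) x).re = φ δ - φ ε := by
      intro ε δ
      simp [hφ]
    have hmono : ∀ ε δ, 0 < ε → ε ≤ δ → φ ε ≤ φ δ := by
      intro ε δ hε hεδ
      have := hre _ x (sub_nonneg.2 (hM ε δ hε hεδ))
      rw [hdiff] at this
      linarith
    obtain ⟨l, hl⟩ : ∃ l, Tendsto φ (𝓝[>] 0) (𝓝 l) := by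
      refine ⟨sInf (φ '' Set.Ioi 0), ?_⟩
      refine MonotoneOn.tendsto_nhdsGT (fun a ha b _ hab => hmono a b ha hab) ?_
      exact ⟨0, by rintro _ ⟨a, _, rfl⟩; exact hre _ x (h0 a)⟩
    have hbound : ∀ ε δ, 0 < ε → ε ≤ δ → δ ≤ 1 →
        ‖M δ x - M ε x‖ ^ 2 ≤ ‖M 1‖ * |φ δ - φ ε| := by
      intro ε δ hε hεδ hδ
      have hD : 0 ≤ M δ - M ε := sub_nonneg.2 (hM ε δ hε hεδ)
      have h1 := norm_apply_sq_le hD x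
      rw [hdiff] at h1
      have h2 : ‖M δ - M ε‖ ≤ ‖M 1‖ := by
        refine CStarAlgebra.norm_le_norm_of_nonneg_of_le hD ?_
        exact (sub_le_self _ (h0 ε)).trans (hM δ 1 (hε.trans_le hεδ) hδ)
      have h3 : φ δ - φ ε ≤ |φ δ - φ ε| := le_abs_self _
      have h4 : 0 ≤ φ δ - φ ε := sub_nonneg.2 (hmono ε δ hε hεδ)
      calc ‖M δ x - M ε x‖ ^ 2 ≤ ‖M δ - M ε‖ * (φ δ - φ ε) := h1
        _ ≤ ‖M 1‖ * |φ δ - φ ε| := mul_le_mul h2 h3 h4 (norm_nonneg _)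
    have hbound' : ∀ ε δ, 0 < ε → 0 < δ → ε ≤ 1 → δ ≤ 1 →
        ‖M δ x - M ε x‖ ^ 2 ≤ ‖M 1‖ * |φ δ - φ ε| := by
      intro ε δ hε hδ hε1 hδ1
      rcases le_total ε δ with h | h
      · exact hbound ε δ hε h hδ1
      · rw [norm_sub_rev, abs_sub_comm]
        exact hbound δ ε hδ h hε1
    refine cauchy_map_iff_exists_tendsto.1 (Metric.cauchy_iff.2 ⟨inferInstance, ?_⟩)
    intro r hr
    obtain ⟨t, ht, htd⟩ := (Metric.cauchy_iff.1 hl.cauchy_map).2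
      (r ^ 2 / (‖M 1‖ + 1)) (by positivity)
    have hI : Set.Ioc (0 : ℝ) 1 ∈ 𝓝[>] (0 : ℝ) := Ioc_mem_nhdsGT one_pos
    refine ⟨(fun ε => M ε x) '' (φ ⁻¹' t ∩ Set.Ioc 0 1),
      image_mem_map (inter_mem (mem_map.1 ht) hI), ?_⟩
    rintro _ ⟨δ, ⟨hδt, hδ⟩, rfl⟩ _ ⟨ε, ⟨hεt, hε⟩, rfl⟩
    have h1 := htd _ hδt _ hεt
    rw [Real.dist_eq, lt_div_iff₀ (by positivity)] at h1
    have h2 := hbound' ε δ hε.1 hδ.1 hε.2 hδ.2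
    rw [dist_eq_norm]
    refine lt_of_pow_lt_pow_left₀ 2 hr.le ?_
    have h3 := abs_nonneg (φ δ - φ ε)
    nlinarith
  choose g hg using key
  exact ⟨continuousLinearMapOfTendsto M (tendsto_pi_nhds.2 hg), hg⟩

/-- The strong limit that defines the geometric mean exists. -/
lemma geoMean_spec {A B : H →L[ℂ] H} (hA : 0 ≤ A) (hB : 0 ≤ B) :
    IsGeoMean A B (geoMean A B) := by
  have hle : ∀ ε δ : ℝ, ε ≤ δ → ε • (1 : H →L[ℂ] H) ≤ δ • (1 : H →L[ℂ] H) := fun ε δ h =>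
    smul_le_smul_of_nonneg_right h zero_le_one
  obtain ⟨G, hG⟩ := exists_strong_limit
    (fun ε : ℝ => geoFormula (A + ε • (1 : H →L[ℂ] H)) (B + ε • (1 : H →L[ℂ] H)))
    (fun ε => geoFormula_nonneg _ _)
    (fun ε δ hε hεδ => geoFormula_mono (isStrictlyPositive_add_smul hA hε)
      (isStrictlyPositive_add_smul hB hε).nonneg
      (add_le_add_right (hle ε δ hεδ) _) (add_le_add_right (hle ε δ hεδ) _))
  have h : IsGeoMean A B G := hG
  rwa [geoMean_eq h]

/-- For invertible `A` the geometric mean is given by the usual formula. -/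
lemma geoMean_of_isUnit {A B : H →L[ℂ] H} (hA : 0 ≤ A) (hAu : IsUnit A) (hB : 0 ≤ B) :
    geoMean A B =
      A ^ (1 / 2 : ℝ) * (A ^ (-(1 / 2) : ℝ) * B * A ^ (-(1 / 2) : ℝ)) ^ (1 / 2 : ℝ) *
        A ^ (1 / 2 : ℝ) := by
  have hAp : IsStrictlyPositive A := hAu.isStrictlyPositive hA
  have hlim : ∀ C : H →L[ℂ] H,
      Tendsto (fun ε : ℝ => C + ε • (1 : H →L[ℂ] H)) (𝓝[>] 0) (𝓝 C) := by
    intro C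
    have : Continuous (fun ε : ℝ => C + ε • (1 : H →L[ℂ] H)) := by fun_prop
    simpa using (this.tendsto 0).mono_left nhdsWithin_le_nhds
  have hpow : ∀ r : ℝ, Tendsto (fun ε : ℝ => (A + ε • (1 : H →L[ℂ] H)) ^ r) (𝓝[>] 0)
      (𝓝 (A ^ r)) := fun r =>
    ((CFC.continuousOn_rpow (A := H →L[ℂ] H) r) A hAp).tendsto.comp
      (tendsto_nhdsWithin_iff.2 ⟨hlim A, eventually_nhdsWithin_of_forall
        fun ε hε => isStrictlyPositive_add_smul hA hε⟩)
  have hin := ((hpow (-(1 / 2))).mul (hlim B)).mul (hpow (-(1 / 2)))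
  have hs : ∀ C : H →L[ℂ] H, IsSelfAdjoint (C ^ (-(1 / 2) : ℝ)) := fun C =>
    IsSelfAdjoint.of_nonneg CFC.rpow_nonneg
  have hsq := ((CFC.continuousOn_sqrt (A := H →L[ℂ] H)) _
    ((hs A).conjugate_nonneg hB)).tendsto.comp
      (tendsto_nhdsWithin_iff.2 ⟨hin, eventually_nhdsWithin_of_forall
        fun ε hε => (hs _).conjugate_nonneg (isStrictlyPositive_add_smul hB hε).nonneg⟩)
  have htot := ((hpow (1 / 2)).mul hsq).mul (hpow (1 / 2))
  refine geoMean_eq fun x => ?_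
  have hx := ((ContinuousLinearMap.apply ℂ H x).continuous.tendsto _).comp htot
  simpa [geoFormula, CFC.sqrt_eq_rpow, Function.comp_def] using hx

end OpMean

/-!
Put `K = g(|T*|)`. Two inequalities combine to the bound.

* A mixed Schwarz inequality: `2 ℜ(ST) ≤ S K S* + f(|T|)|T|`. If `T = K^{1/2} Y` with
  `Y* Y = f(|T|)|T|`, this is the operator arithmetic-geometric mean inequality
  `XY + (XY)* ≤ XX* + Y*Y` for `X = S K^{1/2}`. Such a `Y` comes from the polar decomposition
  `T = U|T|` as `U √(|T| f(|T|))`, because `√(g(t)) √(t f(t)) = t` and `U` intertwines `|T|` and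
  `|T*|`. To avoid partial isometries, `U` is replaced by `T (|T| + ε)⁻¹`, and `ε` tends to `0`
  (`mul_add_star_mul_le_of_mul_eq`). The intertwining of functions of `|T|` and `|T*|` by `T` is
  `semiconjBy_cfc` with `semiconjBy_abs`.
* A lower bound for the geometric mean: `S K S* ≤ (S K² S*) ♯ (S S*)`
  (`OpMean.conjugate_le_geoMean`). The geometric mean dominates every positive solution `G` of
  `G A⁻¹ G ≤ B` (`OpMean.le_geoFormula_of_riccati_le`). For `G = S K S*` and
  `A = S K² S* + ε = (SK)(SK)* + ε` this inequality holds because `A^{-1/2} S K` is a contraction.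

The bound for `-ℜ(ST)` is the bound for `ℜ(ST)` with `-S` in place of `S`, as the right-hand side
does not change.
-/

/-! ### Intertwining and the mixed Schwarz inequality -/

/-- A continuous function of positive elements inherits every intertwining relation: this holds for
polynomials, and polynomials approximate the function uniformly on an interval that contains both
spectra. -/
lemma semiconjBy_cfc {A : Type*} [CStarAlgebra A] [PartialOrder A] [StarOrderedRing A]
    {x a b : A} (ha : 0 ≤ a) (hb : 0 ≤ b) (h : SemiconjBy x a b) {f : ℝ → ℝ}
    (hf : ContinuousOn f (Set.Ici 0)) : SemiconjBy x (cfc f a) (cfc f b) := by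
  set M : ℝ := max (‖a‖ * ‖(1 : A)‖) (‖b‖ * ‖(1 : A)‖)
  have hsa : spectrum ℝ a ⊆ Set.Icc 0 M := fun t ht => ⟨spectrum_nonneg_of_nonneg ha ht,
    ((le_abs_self t).trans (spectrum.norm_le_norm_mul_of_mem ht)).trans (le_max_left _ _)⟩
  have hsb : spectrum ℝ b ⊆ Set.Icc 0 M := fun t ht => ⟨spectrum_nonneg_of_nonneg hb ht,
    ((le_abs_self t).trans (spectrum.norm_le_norm_mul_of_mem ht)).trans (le_max_right _ _)⟩
  have hfM : ContinuousOn f (Set.Icc 0 M) := hf.mono Set.Icc_subset_Ici_self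
  have hpoly : ∀ p : Polynomial ℝ, x * cfc p.eval a = cfc p.eval b * x := by
    intro p
    rw [cfc_polynomial p a, cfc_polynomial p b]
    induction p using Polynomial.induction_on' with
    | add p q hp hq => rw [map_add, map_add, mul_add, add_mul, hp, hq]
    | monomial n r =>
      rw [Polynomial.aeval_monomial, Polynomial.aeval_monomial, mul_assoc,
        ← (h.pow_right n).eq, ← mul_assoc, ← mul_assoc, Algebra.commutes r x]
  have happrox : ∀ {c : A} {p : Polynomial ℝ} {δ : ℝ}, 0 ≤ c → spectrum ℝ c ⊆ Set.Icc 0 M →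
      (∀ t ∈ Set.Icc 0 M, |p.eval t - f t| < δ) → 0 < δ → ‖cfc p.eval c - cfc f c‖ ≤ δ := by
    intro c p δ hc hs hp hδ
    rw [← cfc_sub p.eval f c p.continuous.continuousOn (hfM.mono hs)]
    exact norm_cfc_le hδ.le fun t ht => (hp t (hs ht)).le
  refine sub_eq_zero.1 (norm_eq_zero.1 (le_antisymm (le_of_forall_pos_le_add fun ε hε => ?_)
    (norm_nonneg _)))
  set δ : ℝ := ε / (2 * (‖x‖ + 1)) with hδ
  have hδ0 : 0 < δ := by positivity
  obtain ⟨p, hp⟩ := exists_polynomial_near_of_continuousOn 0 M f hfM δ hδ0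
  have e : x * cfc f a - cfc f b * x =
      (cfc p.eval b - cfc f b) * x - x * (cfc p.eval a - cfc f a) := by
    rw [sub_mul, mul_sub, hpoly p]
    abel
  have h1 := happrox ha hsa hp hδ0
  have h2 := happrox hb hsb hp hδ0
  rw [e]
  calc ‖(cfc p.eval b - cfc f b) * x - x * (cfc p.eval a - cfc f a)‖
      ≤ ‖cfc p.eval b - cfc f b‖ * ‖x‖ + ‖x‖ * ‖cfc p.eval a - cfc f a‖ :=
        (norm_sub_le _ _).trans (add_le_add (norm_mul_le _ _) (norm_mul_le _ _))
    _ ≤ δ * ‖x‖ + ‖x‖ * δ := by gcongr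
    _ ≤ δ * (2 * (‖x‖ + 1)) := by nlinarith
    _ = 0 + ε := by rw [hδ]; field_simp; simp

lemma semiconjBy_abs {A : Type*} [CStarAlgebra A] [PartialOrder A] [StarOrderedRing A] (T : A) :
    SemiconjBy T (CFC.abs T) (CFC.abs (star T)) := by
  have hs : ∀ x : A, CFC.abs x = cfc Real.sqrt (star x * x) := fun x => by
    rw [CFC.abs, CFC.sqrt_eq_real_sqrt _ (star_mul_self_nonneg x), cfcₙ_eq_cfc]
  rw [hs, hs]
  refine semiconjBy_cfc (star_mul_self_nonneg T) (star_mul_self_nonneg _) ?_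
    Real.continuous_sqrt.continuousOn
  rw [SemiconjBy, star_star, mul_assoc]

lemma mul_add_star_mul_le {A : Type*} [CStarAlgebra A] [PartialOrder A] [StarOrderedRing A]
    (X Y : A) : X * Y + star (X * Y) ≤ X * star X + star Y * Y := by
  have h := mul_star_self_nonneg (X - star Y)
  have e : (X - star Y) * star (X - star Y) =
      (X * star X + star Y * Y) - (X * Y + star (X * Y)) := by
    rw [star_sub, star_star, star_mul]
    noncomm_ring
  rw [e] at h
  exact sub_nonneg.1 h

lemma star_mul_self_mul_cfc_abs {A : Type*} [CStarAlgebra A] [PartialOrder A] [StarOrderedRing A]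
    (T : A) {w : ℝ → ℝ} (hw : ContinuousOn w (Set.Ici 0)) :
    star (T * cfc w (CFC.abs T)) * (T * cfc w (CFC.abs T)) =
      cfc (fun t => (t * w t) ^ 2) (CFC.abs T) := by
  set a := CFC.abs T with ha
  have ha0 : 0 ≤ a := CFC.abs_nonneg T
  have hw' : ContinuousOn w (spectrum ℝ a) :=
    hw.mono fun t ht => spectrum_nonneg_of_nonneg ha0 ht
  have hws : star (cfc w a) = cfc w a := (cfc_predicate w a : IsSelfAdjoint _)
  have e : star (T * cfc w a) * (T * cfc w a) = (cfc w a * a) * (a * cfc w a) := by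
    rw [star_mul, hws, mul_assoc, ← mul_assoc (star T), ← CFC.abs_mul_abs T, ← ha]
    noncomm_ring
  have h1 : cfc w a * a = cfc (fun t => w t * t) a := by
    rw [cfc_mul w (fun t => t) a hw' continuousOn_id, cfc_id' ℝ a]
  have h2 : a * cfc w a = cfc (fun t => t * w t) a := by
    rw [cfc_mul (fun t => t) w a continuousOn_id hw', cfc_id' ℝ a]
  rw [e, h1, h2, ← cfc_mul (fun t => w t * t) (fun t => t * w t) a
    (hw'.mul continuousOn_id) (continuousOn_id.mul hw')]
  exact cfc_congr fun t _ => by ring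

/-- The operator form of the mixed Schwarz inequality, for the pair of functions `√(t f(t))`,
`√(g(t))` with product `t`. The factorization `T = √g(|T*|) · Y` with `Y*Y = f(|T|)|T|` need not
exist in the algebra (it uses the polar decomposition), so `Y` is replaced by
`T √(t f(t)) / (t + ε)` evaluated at `t = |T|`. -/
lemma mul_add_star_mul_le_of_mul_eq {A : Type*} [CStarAlgebra A] [PartialOrder A]
    [StarOrderedRing A] (S T : A) {f g : ℝ → ℝ}
    (hf : ContinuousOn f (Set.Ici 0)) (hg : ContinuousOn g (Set.Ici 0))
    (hf0 : ∀ t : ℝ, 0 ≤ t → 0 ≤ f t) (hg0 : ∀ t : ℝ, 0 ≤ t → 0 ≤ g t)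
    (hfg : ∀ t : ℝ, 0 ≤ t → f t * g t = t) :
    S * T + star (S * T) ≤
      S * cfc g (CFC.abs (star T)) * star S + cfc f (CFC.abs T) * CFC.abs T := by
  set a := CFC.abs T with ha
  set b := CFC.abs (star T)
  have ha0 : 0 ≤ a := CFC.abs_nonneg T
  have hb0 : 0 ≤ b := CFC.abs_nonneg (star T)
  have hsa : spectrum ℝ a ⊆ Set.Ici 0 := fun t ht => spectrum_nonneg_of_nonneg ha0 ht
  have hasa : IsSelfAdjoint a := .of_nonneg ha0
  have hsb : spectrum ℝ b ⊆ Set.Ici 0 := fun t ht => spectrum_nonneg_of_nonneg hb0 ht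
  let k : ℝ → ℝ := fun t => √(g t)
  have hk : ContinuousOn k (Set.Ici 0) := hg.sqrt
  have hkb : cfc k b * cfc k b = cfc g b := by
    rw [← cfc_mul k k b (hk.mono hsb) (hk.mono hsb)]
    exact cfc_congr fun t ht => Real.mul_self_sqrt (hg0 t (hsb ht))
  let h : ℝ → ℝ := fun t => √(f t * t)
  have hh : ContinuousOn h (Set.Ici 0) := (hf.mul continuousOn_id).sqrt
  have hkh : ∀ t, 0 ≤ t → k t * h t = t := by
    intro t ht
    rw [← Real.sqrt_mul (hg0 t ht), ← mul_assoc, mul_comm (g t), hfg t ht, Real.sqrt_mul_self ht]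
  have hinv : ∀ ε : ℝ, 0 < ε → ContinuousOn (fun t : ℝ => (t + ε)⁻¹) (Set.Ici 0) := fun ε hε =>
    ContinuousOn.inv₀ (by fun_prop) fun t (ht : 0 ≤ t) => by positivity
  have hfa : cfc f a * a = cfc (fun t => f t * t) a := by
    rw [cfc_mul f (fun t => t) a (hf.mono hsa) continuousOn_id, cfc_id' ℝ a]
  let Y : ℝ → A := fun ε => T * cfc (fun t => h t * (t + ε)⁻¹) a
  have hY : ∀ ε, 0 < ε → star (Y ε) * Y ε ≤ cfc f a * a := by
    intro ε hε
    have hc : ContinuousOn (fun t => h t * (t + ε)⁻¹) (Set.Ici 0) := hh.mul (hinv ε hε)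
    change star (T * cfc (fun t => h t * (t + ε)⁻¹) a) *
      (T * cfc (fun t => h t * (t + ε)⁻¹) a) ≤ _
    rw [star_mul_self_mul_cfc_abs T hc, hfa]
    refine cfc_mono (fun t ht => ?_) (((continuousOn_id.mul hc).pow 2).mono hsa)
      ((hf.mul continuousOn_id).mono hsa)
    have ht0 : 0 ≤ t := hsa ht
    have hle : t * (t + ε)⁻¹ ≤ 1 := by
      rw [← div_eq_mul_inv, div_le_one (by positivity)]
      linarith
    have h0 : 0 ≤ t * (t + ε)⁻¹ := by positivity
    have hft : 0 ≤ f t * t := mul_nonneg (hf0 t ht0) ht0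
    calc (t * (h t * (t + ε)⁻¹)) ^ 2 = (t * (t + ε)⁻¹) ^ 2 * h t ^ 2 := by ring
      _ ≤ 1 * h t ^ 2 := by
        gcongr
        exact pow_le_one₀ h0 hle
      _ = f t * t := by rw [one_mul, Real.sq_sqrt hft]
  have hTY : ∀ ε, 0 < ε → ‖cfc k b * Y ε - T‖ ≤ ε := by
    intro ε hε
    have hc : ContinuousOn (fun t => h t * (t + ε)⁻¹) (Set.Ici 0) := hh.mul (hinv ε hε)
    have e1 : cfc k b * Y ε = T * cfc (fun t => k t * (h t * (t + ε)⁻¹)) a := by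
      rw [← mul_assoc, ← (semiconjBy_cfc ha0 hb0 (semiconjBy_abs T) hk).eq, mul_assoc,
        ← cfc_mul k _ a (hk.mono hsa) (hc.mono hsa)]
    have hc' : ContinuousOn (fun t => k t * (h t * (t + ε)⁻¹)) (Set.Ici 0) := hk.mul hc
    have hc1 : ContinuousOn (fun t => k t * (h t * (t + ε)⁻¹) - 1) (Set.Ici 0) :=
      hc'.sub continuousOn_const
    -- As `k t * h t = t`, the error is `T` times `-ε / (t + ε)`, and `ε t / (t + ε) ≤ ε`.
    have e2 : cfc k b * Y ε - T = T * cfc (fun t => k t * (h t * (t + ε)⁻¹) - 1) a := by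
      rw [e1, cfc_sub (fun t => k t * (h t * (t + ε)⁻¹)) (fun _ => 1) a (hc'.mono hsa)
        continuousOn_const, cfc_const_one ℝ a hasa, mul_sub, mul_one]
    rw [e2]
    refine le_of_sq_le_sq ?_ hε.le
    rw [sq, ← CStarRing.norm_star_mul_self, star_mul_self_mul_cfc_abs T hc1]
    refine norm_cfc_le (by positivity) fun t ht => ?_
    have ht0 : 0 ≤ t := hsa ht
    have e3 : t * (k t * (h t * (t + ε)⁻¹) - 1) = -(ε * (t * (t + ε)⁻¹)) := by
      rw [← mul_assoc, hkh t ht0]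
      field_simp
      ring
    have hle : t * (t + ε)⁻¹ ≤ 1 := by
      rw [← div_eq_mul_inv, div_le_one (by positivity)]
      linarith
    have h0 : 0 ≤ t * (t + ε)⁻¹ := by positivity
    rw [e3, neg_sq, Real.norm_of_nonneg (sq_nonneg _), mul_pow]
    exact mul_le_of_le_one_right (sq_nonneg ε) (pow_le_one₀ h0 hle)
  have hlim : Tendsto (fun ε => cfc k b * Y ε) (𝓝[>] 0) (𝓝 T) := by
    rw [tendsto_iff_norm_sub_tendsto_zero]
    exact squeeze_zero' (Eventually.of_forall fun _ => norm_nonneg _)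
      (eventually_nhdsWithin_of_forall hTY) nhdsWithin_le_nhds
  have hlim' := hlim.const_mul S
  refine le_of_tendsto (hlim'.add hlim'.star) (eventually_nhdsWithin_of_forall fun ε hε => ?_)
  have hks : star (cfc k b) = cfc k b := (cfc_predicate k b : IsSelfAdjoint _)
  have h1 := mul_add_star_mul_le (S * cfc k b) (Y ε)
  have e : S * cfc k b * star (S * cfc k b) = S * cfc g b * star S := by
    rw [star_mul, hks, ← hkb]
    noncomm_ring
  rw [e, mul_assoc] at h1
  exact h1.trans (add_le_add_right (hY ε hε) _)

/-! ### Lower bounds for the geometric mean -/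

/-- If `W W* ≤ a` for a positive invertible `a`, then `a^{-1/2} W` is a contraction. -/
lemma star_mul_rpow_neg_one_mul_le_one {A : Type*} [CStarAlgebra A] [PartialOrder A]
    [StarOrderedRing A] {a W : A} (ha : IsStrictlyPositive a) (h : W * star W ≤ a) :
    star W * a ^ (-1 : ℝ) * W ≤ 1 := by
  have hQ : IsSelfAdjoint (a ^ (-(1 / 2) : ℝ)) := IsSelfAdjoint.of_nonneg CFC.rpow_nonneg
  have hQQ : a ^ (-(1 / 2) : ℝ) * a ^ (-(1 / 2) : ℝ) = a ^ (-1 : ℝ) := by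
    rw [← CFC.rpow_add ha.isUnit]
    norm_num
  have hQaQ : a ^ (-(1 / 2) : ℝ) * a * a ^ (-(1 / 2) : ℝ) = 1 := by
    have h1 : a ^ (-(1 / 2) : ℝ) * a ^ (1 : ℝ) * a ^ (-(1 / 2) : ℝ) = 1 := by
      rw [← CFC.rpow_add ha.isUnit, ← CFC.rpow_add ha.isUnit]
      norm_num
      exact CFC.rpow_zero a ha.nonneg
    rwa [CFC.rpow_one a ha.nonneg] at h1
  have h2 := hQ.conjugate_le_conjugate h
  rw [hQaQ] at h2
  set Q := a ^ (-(1 / 2) : ℝ)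
  have e1 : Q * (W * star W) * Q = (Q * W) * star (Q * W) := by
    rw [star_mul, hQ.star_eq]
    noncomm_ring
  have e2 : star W * a ^ (-1 : ℝ) * W = star (Q * W) * (Q * W) := by
    rw [star_mul, hQ.star_eq, ← hQQ]
    noncomm_ring
  rw [e1, ← CStarAlgebra.norm_le_one_iff_of_nonneg _ (mul_star_self_nonneg _),
    CStarRing.norm_self_mul_star, ← CStarRing.norm_star_mul_self] at h2
  rwa [e2, ← CStarAlgebra.norm_le_one_iff_of_nonneg _ (star_mul_self_nonneg _)]

namespace OpMean

variable {H : Type*} [NormedAddCommGroup H] [InnerProductSpace ℂ H] [CompleteSpace H]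

/-- The geometric mean of `A` and `B` is the largest positive solution `G` of the Riccati
inequality `G A⁻¹ G ≤ B`. -/
lemma le_geoFormula_of_riccati_le {A B G : H →L[ℂ] H} (hA : IsStrictlyPositive A) (hG : 0 ≤ G)
    (h : G * A ^ (-1 : ℝ) * G ≤ B) : G ≤ geoFormula A B := by
  have e1 := CFC.rpow_mul_rpow_neg (1 / 2) hA
  have e2 := CFC.rpow_neg_mul_rpow (1 / 2) hA
  have hP : IsSelfAdjoint (A ^ (1 / 2 : ℝ)) := IsSelfAdjoint.of_nonneg CFC.rpow_nonneg
  have hQ : IsSelfAdjoint (A ^ (-(1 / 2) : ℝ)) := IsSelfAdjoint.of_nonneg CFC.rpow_nonneg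
  rw [← neg_half_mul_neg_half hA] at h
  have h2 := hQ.conjugate_le_conjugate h
  rw [geoFormula]
  set P := A ^ (1 / 2 : ℝ)
  set Q := A ^ (-(1 / 2) : ℝ)
  have h3 : Q * (G * (Q * Q) * G) * Q = (Q * G * Q) * (Q * G * Q) := by noncomm_ring
  rw [h3] at h2
  have h4 := CFC.sqrt_le_sqrt _ _ h2
  rw [CFC.sqrt_mul_self _ (hQ.conjugate_nonneg hG), CFC.sqrt_eq_rpow] at h4
  have h5 := hP.conjugate_le_conjugate h4
  have h6 : P * (Q * G * Q) * P = (P * Q) * G * (Q * P) := by noncomm_ring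
  rwa [h6, e1, e2, one_mul, mul_one] at h5

open scoped ComplexOrder in
lemma le_geoMean {A B G : H →L[ℂ] H} (hA : 0 ≤ A) (hB : 0 ≤ B)
    (h : ∀ ε : ℝ, 0 < ε → G ≤ geoFormula (A + ε • (1 : H →L[ℂ] H)) (B + ε • (1 : H →L[ℂ] H))) :
    G ≤ geoMean A B := by
  -- Strong convergence suffices, since positivity is tested on the numbers `⟪D x, x⟫`.
  have hlim := geoMean_spec hA hB
  rw [← sub_nonneg, ContinuousLinearMap.nonneg_iff_isPositive,
    ContinuousLinearMap.isPositive_iff_complex]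
  have hpos : ∀ x : H, 0 ≤ (inner ℂ ((geoMean A B - G) x) x : ℂ) := by
    intro x
    have ht : Tendsto (fun ε : ℝ => (inner ℂ ((geoFormula (A + ε • (1 : H →L[ℂ] H))
        (B + ε • (1 : H →L[ℂ] H)) - G) x) x : ℂ)) (𝓝[>] 0)
        (𝓝 (inner ℂ ((geoMean A B - G) x) x)) := by
      simp only [sub_apply]
      exact ((hlim x).sub_const _).inner tendsto_const_nhds
    refine isClosed_Ici.mem_of_tendsto ht (eventually_nhdsWithin_of_forall fun ε hε => ?_)
    exact ((ContinuousLinearMap.nonneg_iff_isPositive _).1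
      (sub_nonneg.2 (h ε hε))).inner_nonneg_left x
  intro x
  have := RCLike.nonneg_iff.1 (hpos x)
  exact ⟨RCLike.conj_eq_iff_re.1 (RCLike.conj_eq_iff_im.2 this.2), this.1⟩

/-- For commuting operators this is an equality: `√(S K² S* · S S*) = S K S*`. The contraction
`A^{-1/2} S K` with `A = S K² S* + ε` gives the Riccati inequality for `S K S*`. -/
lemma conjugate_le_geoMean (S : H →L[ℂ] H) {K : H →L[ℂ] H} (hK : 0 ≤ K) :
    S * K * star S ≤ geoMean (S * K ^ 2 * star S) (S * star S) := by
  have hKs : star K = K := (IsSelfAdjoint.of_nonneg hK).star_eq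
  have e : S * K ^ 2 * star S = (S * K) * star (S * K) := by
    rw [star_mul, hKs]
    noncomm_ring
  have hA : 0 ≤ S * K ^ 2 * star S := e ▸ mul_star_self_nonneg _
  have hB : 0 ≤ S * star S := mul_star_self_nonneg S
  refine le_geoMean hA hB fun ε hε => ?_
  have hA' := isStrictlyPositive_add_smul hA hε
  have hε1 : 0 ≤ ε • (1 : H →L[ℂ] H) := smul_nonneg hε.le zero_le_one
  refine le_geoFormula_of_riccati_le hA' (star_right_conjugate_nonneg hK S) ?_
  have h1 : star (S * K) * (S * K ^ 2 * star S + ε • (1 : H →L[ℂ] H)) ^ (-1 : ℝ) * (S * K) ≤ 1 :=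
    star_mul_rpow_neg_one_mul_le_one hA' (e ▸ le_add_of_nonneg_right hε1)
  have h2 := star_right_conjugate_le_conjugate h1 S
  rw [star_mul, hKs, mul_one] at h2
  refine le_trans (le_of_eq ?_) (h2.trans (le_add_of_nonneg_right hε1))
  noncomm_ring

end OpMean

/-! ### The bound for the real part of a product -/

lemma realPart_mul_le_geoMean_add {H : Type*} [NormedAddCommGroup H] [InnerProductSpace ℂ H]
    [CompleteSpace H] (S T : H →L[ℂ] H) {f g : ℝ → ℝ}
    (hf : ContinuousOn f (Set.Ici 0)) (hg : ContinuousOn g (Set.Ici 0))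
    (hf0 : ∀ t : ℝ, 0 ≤ t → 0 ≤ f t) (hg0 : ∀ t : ℝ, 0 ≤ t → 0 ≤ g t)
    (hfg : ∀ t : ℝ, 0 ≤ t → f t * g t = t) :
    (ℜ (S * T) : H →L[ℂ] H) ≤
      (1 / 2 : ℝ) • (OpMean.geoMean (S * cfc g (CFC.abs (star T)) ^ 2 * star S)
        (CFC.abs (star S) ^ 2) + cfc f (CFC.abs T) * CFC.abs T) := by
  have hK : 0 ≤ cfc g (CFC.abs (star T)) := cfc_nonneg fun t ht =>
    hg0 t (spectrum_nonneg_of_nonneg (CFC.abs_nonneg (star T)) ht)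
  have hSS : CFC.abs (star S) ^ 2 = S * star S := by
    rw [sq, CFC.abs_mul_abs, star_star]
  rw [realPart_apply_coe, hSS, ← one_div]
  refine smul_le_smul_of_nonneg_left ?_ (by norm_num)
  exact (mul_add_star_mul_le_of_mul_eq S T hf hg hf0 hg0 hfg).trans
    (add_le_add_left (OpMean.conjugate_le_geoMean S hK) _)

theorem theorem23 {H : Type*} [NormedAddCommGroup H] [InnerProductSpace ℂ H] [CompleteSpace H]
    (S T : H →L[ℂ] H) (f g : ℝ → ℝ)
    (hf : ContinuousOn f (Set.Ici 0)) (hg : ContinuousOn g (Set.Ici 0))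
    (hf0 : ∀ t : ℝ, 0 ≤ t → 0 ≤ f t) (hg0 : ∀ t : ℝ, 0 ≤ t → 0 ≤ g t)
    (hfg : ∀ t : ℝ, 0 ≤ t → f t * g t = t) :
    (ℜ (S * T) : H →L[ℂ] H) ≤
        (1 / 2 : ℝ) • (OpMean.geoMean (S * cfc g (CFC.abs (star T)) ^ 2 * star S)
          (CFC.abs (star S) ^ 2) + cfc f (CFC.abs T) * CFC.abs T) ∧
      -(ℜ (S * T) : H →L[ℂ] H) ≤
        (1 / 2 : ℝ) • (OpMean.geoMean (S * cfc g (CFC.abs (star T)) ^ 2 * star S)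
          (CFC.abs (star S) ^ 2) + cfc f (CFC.abs T) * CFC.abs T) := by
  have h := realPart_mul_le_geoMean_add (-S) T hf hg hf0 hg0 hfg
  rw [star_neg, CFC.abs_neg, neg_mul, neg_mul, neg_mul_neg, map_neg] at h
  exact ⟨realPart_mul_le_geoMean_add S T hf hg hf0 hg0 hfg, h⟩
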